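/- Let $m,\ell,k$ denote natural numbers. For structures $\mathfrak O,\mathfrak N,\mathfrak A$ in the same signature, write $\mathfrak O\longrightarrow(\mathfrak N)^{\mathfrak A}_{k,\ell}$ if for every map $c$ from the set of all substructures of $\mathfrak O$ isomorphic to $\mathfrak A$ to a set of $k$ colors there is a substructure $\mathfrak N'$ of $\mathfrak O$ isomorphic to $\mathfrak N$ such that $c$ takes at most $\ell$ values on the substructures of $\mathfrak N'$ isomorphic to $\mathfrak A$. A finite structure $\mathcal A$ has finite big Ramsey degree in an infinite structure $\mathfrak N$ if there is an $\ell$ such that $\mathfrak N\longrightarrow(\mathfrak N)^{\mathcal A}_{k,\ell}$ for every $k$; otherwise $\mathcal A$ has infinite big Ramsey degree in $\mathfrak N$. Assume the Continuum Hypothesis, $2^{\aleph_0}=\aleph_1$. Let $\mathscr D$ be an ultrafilter on $\omega$, let $(\mathcal M_i)_{i\in\omega}$ be a sequence of finite nonempty linear orders, and suppose that the ultraproduct $\mathfrak L^*=\prod_{i\in\omega}\mathcal M_i/\mathscr D$ is infinite. Then for every $m\ge 2$, $m$-tuples have infinite big Ramsey degree in $\mathfrak L^*$; that is, the $m$-element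 linear order has infinite big Ramsey degree in $\mathfrak L^*$, where linear orders are regarded as structures in the signature of orders. Explicitly: for every $\ell$ there are a $k$ and a coloring (arbitrary, not necessarily internal) of the $m$-element subsets of $\mathfrak L^*$ with $k$ colors that takes more than $\ell$ values on the $m$-element subsets of every suborder of $\mathfrak L^*$ isomorphic to $\mathfrak L^*$. -/

import Mathlib

open FirstOrder

namespace BigRamsey

universe u v w w₁ w₂

section Partition

variable (L : FirstOrder.Language.{u, v})

/-- The set of all substructures of `N` that are isomorphic to `A` (the copies of `A` in `N`). -/
def copies (A : Type w₁) (N : Type w) [L.Structure A] [L.Structure N] : Set (L.Substructure N) :=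
  {S | Nonempty (S ≃[L] A)}

/-- The set of colors that the coloring `c` of the copies of `A` in `O` takes on those copies
of `A` that are contained in the substructure `S` of `O`. -/
def colorsOn {A : Type w₁} {O : Type w} [L.Structure A] [L.Structure O] {k : ℕ}
    (c : copies L A O → Fin k) (S : L.Substructure O) : Set (Fin k) :=
  {j | ∃ T : copies L A O, T.1 ≤ S ∧ c T = j}

/-- The partition relation `O ⟶ (N)^A_{k,ℓ}`: for every coloring of the copies of `A` in `O` with
`k` colors there is a copy `N'` of `N` in `O` such that at most `ℓ` colors occur on the copies
of `A` in `N'`. The coloring is arbitrary. -/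
def Arrow (O : Type w) (N : Type w₂) (A : Type w₁) [L.Structure O] [L.Structure N]
    [L.Structure A] (k ℓ : ℕ) : Prop :=
  ∀ c : copies L A O → Fin k, ∃ N' ∈ copies L N O, (colorsOn L c N').ncard ≤ ℓ

/-- `A` has finite big Ramsey degree in `N`: one `ℓ` works for every number `k` of colors. -/
def HasFiniteBigRamseyDegree (A : Type w₁) (N : Type w) [L.Structure A] [L.Structure N] : Prop :=
  ∃ ℓ : ℕ, ∀ k : ℕ, Arrow L N N A k ℓ

/-- `A` has infinite big Ramsey degree in `N`. -/
def HasInfiniteBigRamseyDegree (A : Type w₁) (N : Type w) [L.Structure A] [L.Structure N] :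
    Prop :=
  ¬ HasFiniteBigRamseyDegree L A N

end Partition

/-- The `m`-element linear order `0 < 1 < ⋯ < m - 1` as a structure in the language of orders;
its copies in a linear order are the `m`-element subsets (the increasing `m`-tuples). -/
instance finOrderStructure (m : ℕ) : Language.order.Structure (Fin m) :=
  Language.orderStructure (Fin m)

end BigRamsey

namespace BigRamsey

open Cardinal Set

universe u₁ u₂

/-! Only cardinality matters: under CH the ultraproduct has size `ℵ₁`, so each copy of it is
uncountable, and a coloring with every color on every uncountable set suffices. This is
Sierpiński-style: well-order the points in type `ω₁`, independently of the given order, and index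
all ω-sequences by points. For each `b`, color the points so that every injective sequence indexed
below `b` gets all colors. An uncountable set contains such a sequence and a point `b` above its
terms and its index. For `m > 2`, color a set by its two least points. -/

/-- Countably many infinite sets can be met simultaneously, in every color, by one map to `ℕ`. -/
theorem exists_forall_infinite_image_eq_univ {X : Type u₁} {ι : Type u₂} [Countable ι]
    (s : ι → Set X) (hs : ∀ i, (s i).Infinite) :
    ∃ g : X → ℕ, ∀ i n, ∃ x ∈ s i, g x = n := by
  classical
  obtain ⟨e, he⟩ := exists_injective_nat (ι × ℕ)
  -- Sizes grow with the code `e p`, so the largest set in any finite subfamily already verifies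
  -- Hall's condition; distinct representatives can then be colored freely.
  choose t hts htc using fun p : ι × ℕ => (hs p.1).exists_subset_card_eq (e p + 1)
  obtain ⟨f, hf, hft⟩ :=
    (Finset.all_card_le_biUnion_card_iff_exists_injective t).1 (by
      intro A
      rcases A.eq_empty_or_nonempty with rfl | hA
      · simp
      obtain ⟨p, hp, hmax⟩ := A.exists_max_image e hA
      calc A.card = (A.image e).card := (Finset.card_image_of_injective A he).symm
        _ ≤ (Finset.range (e p + 1)).card := Finset.card_le_card (by
            intro n hn
            obtain ⟨q, hq, rfl⟩ := Finset.mem_image.1 hn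
            exact Finset.mem_range.2 (Nat.lt_succ_of_le (hmax q hq)))
        _ = (t p).card := by rw [htc, Finset.card_range]
        _ ≤ (A.biUnion t).card := Finset.card_le_card (Finset.subset_biUnion_of_mem t hp))
  refine ⟨Function.extend f Prod.snd 0, fun i n => ⟨f (i, n), hts (i, n) (hft (i, n)), ?_⟩⟩
  rw [hf.extend_apply]

/-- In a well-order with countable initial segments and as many points as sequences of points,
the pairs can be colored with countably many colors such that every color occurs on each
uncountable set. -/
theorem exists_pair_coloring {X : Type u₁} [LinearOrder X]
    (hcount : ∀ a : X, (Iio a).Countable) (hseq : #(ℕ → X) ≤ #X) [Nonempty X] :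
    ∃ f : X → X → ℕ, ∀ s : Set X, ¬ s.Countable → ∀ n, ∃ a ∈ s, ∃ b ∈ s, a < b ∧ f a b = n := by
  obtain ⟨ψ⟩ := Cardinal.le_def _ _ |>.1 hseq
  have he := Function.invFun_surjective ψ.injective
  set e : X → ℕ → X := Function.invFun ψ
  have key : ∀ b : X, ∃ g : X → ℕ, ∀ c : X, c < b → (e c).Injective →
      ∀ n, ∃ k, g (e c k) = n := by
    intro b
    have : Countable (Iio b) := (hcount b).to_subtype
    obtain ⟨g, hg⟩ := exists_forall_infinite_image_eq_univ
      (fun c : {c : Iio b // (e c).Injective} => range (e c.1))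
      (fun c => infinite_range_of_injective c.2)
    refine ⟨g, fun c hc hinj n => ?_⟩
    obtain ⟨_, ⟨k, rfl⟩, hk⟩ := hg ⟨⟨c, hc⟩, hinj⟩ n
    exact ⟨k, hk⟩
  choose g hg using key
  refine ⟨fun a b => g b a, fun s hs n => ?_⟩
  have hsinf : s.Infinite := fun h => hs h.countable
  obtain ⟨c, hc⟩ := he (fun n => (hsinf.natEmbedding s n : X))
  have hcinj : (e c).Injective := by
    rw [hc]
    exact Subtype.val_injective.comp (hsinf.natEmbedding s).injective
  have hIic : ∀ a : X, (Iic a).Countable := fun a => by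
    rw [← Iio_insert]
    exact (hcount a).insert a
  obtain ⟨b, hbs, hb⟩ : ∃ b ∈ s, b ∉ Iic c ∪ ⋃ k, Iic (e c k) :=
    not_subset.1 fun h =>
      hs (((hIic c).union (countable_iUnion fun k => hIic (e c k))).mono h)
  simp only [mem_union, mem_Iic, mem_iUnion, not_or, not_le, not_exists] at hb
  obtain ⟨k, hk⟩ := hg b c hb.1 hcinj n
  refine ⟨e c k, ?_, b, hbs, hb.2 k, hk⟩
  rw [hc]
  exact Subtype.property _

/-- Under the Continuum Hypothesis, the finite subsets of a set of size `ℵ₁` can be colored with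
countably many colors such that, for each `m ≥ 2`, every color occurs on the `m`-element subsets
of each uncountable set. -/
theorem exists_set_coloring {X : Type u₁} (hX : #X = ℵ₁) (hCH : 𝔠 = (ℵ₁ : Cardinal.{u₁})) :
    ∃ c : Set X → ℕ, ∀ s : Set X, ¬ s.Countable → ∀ m, 2 ≤ m → ∀ n,
      ∃ t : Finset X, (t : Set X) ⊆ s ∧ t.card = m ∧ c t = n := by
  classical
  obtain ⟨r, hr, hord⟩ := exists_ord_eq X
  let : LinearOrder X := linearOrderOfSTO r
  have hcount : ∀ a : X, (Iio a).Countable := fun a => by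
    have h := card_typein_lt (r := r) a hord
    rw [Ordinal.card_typein, hX] at h
    exact le_aleph0_iff_set_countable.1 (lt_aleph_one_iff.1 h)
  have hseq : #(ℕ → X) ≤ #X := by
    have h : #(ℕ → X) = lift.{0} #X ^ lift.{u₁} #ℕ := mk_arrow ℕ X
    rw [h, hX, ← hCH]
    simp
  have hne : Nonempty X := by
    rw [← mk_ne_zero_iff, hX]
    exact (aleph_pos 1).ne'
  obtain ⟨f, hf⟩ := exists_pair_coloring hcount hseq
  -- `p` is the pair of the two least elements of `t` in the well-order.
  let P : Set X → X × X → Prop := fun t p =>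
    p.1 ∈ t ∧ p.2 ∈ t ∧ p.1 < p.2 ∧ ∀ x ∈ t, x = p.1 ∨ p.2 ≤ x
  have hP : ∀ t p q, P t p → P t q → p = q := by
    rintro t ⟨a, b⟩ ⟨a', b'⟩ ⟨ha, hb, hab, h⟩ ⟨ha', hb', hab', h'⟩
    simp only [] at ha hb hab h ha' hb' hab' h'
    have h1 := h a' ha'
    have h2 := h b' hb'
    have h3 := h' a ha
    have h4 := h' b hb
    grind
  refine ⟨fun t => if h : ∃ p, P t p then f h.choose.1 h.choose.2 else 0,
    fun s hs m hm n => ?_⟩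
  obtain ⟨a, has, b, hbs, hab, hfab⟩ := hf s hs n
  -- The other `m - 2` points are taken above `b`, keeping `a`, `b` the two least.
  have hinf : (s \ Iic b).Infinite := fun h => hs <| by
    have hIic : (Iic b).Countable := by
      rw [← Iio_insert]
      exact (hcount b).insert b
    exact (h.countable.union hIic).mono (by simp)
  obtain ⟨v, hvs, hvc⟩ := hinf.exists_subset_card_eq (m - 2)
  have hv : ∀ x ∈ v, b < x := fun x hx => not_le.1 (hvs hx).2
  have hPt : P (insert a (insert b v) : Finset X) (a, b) := by
    refine ⟨by simp, by simp, hab, fun x hx => ?_⟩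
    simp only [Finset.coe_insert, mem_insert_iff, Finset.mem_coe] at hx
    rcases hx with rfl | rfl | hx
    · exact Or.inl rfl
    · exact Or.inr le_rfl
    · exact Or.inr (hv x hx).le
  refine ⟨insert a (insert b v), ?_, ?_, ?_⟩
  · intro x hx
    simp only [Finset.coe_insert, mem_insert_iff, Finset.mem_coe] at hx
    rcases hx with rfl | rfl | hx
    exacts [has, hbs, (hvs hx).1]
  · have hb : b ∉ v := fun h => (hv b h).false
    have ha : a ∉ insert b v := fun h => by
      rcases Finset.mem_insert.1 h with h | h
      exacts [hab.ne h, hab.not_gt (hv a h)]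
    rw [Finset.card_insert_of_notMem ha, Finset.card_insert_of_notMem hb, hvc]
    omega
  · have h : ∃ p, P (insert a (insert b v) : Finset X) p := ⟨_, hPt⟩
    simp only [dif_pos h]
    rw [hP _ _ _ h.choose_spec hPt]
    exact hfab

section Ultraproduct

variable (D : Ultrafilter ℕ) (M : ℕ → Type u₁) [∀ i, Finite (M i)]

theorem mk_product_le_continuum : #((D : Filter ℕ).Product M) ≤ 𝔠 := by
  refine (mk_quotient_le (s := (D : Filter ℕ).productSetoid M)).trans ?_
  choose φ hφ using fun i => exists_injective_nat (M i)
  have h := mk_le_of_injective (f := fun (x : ∀ i, M i) =>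
    (ULift.up fun i => φ i (x i) : ULift.{u₁} (ℕ → ℕ))) (fun x y hxy => funext fun i =>
      hφ i (congrFun (congrArg ULift.down hxy) i))
  simpa using h

/-- Representatives of `n + 1` distinct classes are pairwise distinct on a set in `D`. -/
theorem eventually_lt_card_of_infinite [hinf : Infinite ((D : Filter ℕ).Product M)] (n : ℕ) :
    ∀ᶠ i in (D : Filter ℕ), n < Nat.card (M i) := by
  let q : (∀ i, M i) → (D : Filter ℕ).Product M :=
    Quotient.mk ((D : Filter ℕ).productSetoid M)
  have hq : Function.Surjective q := Quotient.mk_surjective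
  let φ := Infinite.natEmbedding ((D : Filter ℕ).Product M)
  choose x hx using fun k : Fin (n + 1) => hq (φ k)
  have hne : ∀ j k : Fin (n + 1), j ≠ k → ∀ᶠ i in (D : Filter ℕ), x j i ≠ x k i := by
    intro j k hjk
    refine Ultrafilter.eventually_not.2 fun h => hjk ?_
    have h' : q (x j) = q (x k) := Quotient.sound h
    rw [hx, hx] at h'
    exact Fin.ext (φ.injective h')
  have hall : ∀ᶠ i in (D : Filter ℕ), ∀ j k : Fin (n + 1), j ≠ k → x j i ≠ x k i := by
    simpa only [Filter.eventually_all] using hne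
  filter_upwards [hall] with i hi
  have hinj : Function.Injective fun k => x k i := fun j k h =>
    by_contra fun hjk => hi j k hjk h
  have := Nat.card_le_card_of_injective _ hinj
  rwa [Nat.card_fin] at this

/-- An infinite ultraproduct of finite sets along an ultrafilter on `ℕ` is uncountable. -/
theorem uncountable_product [∀ i, Nonempty (M i)] [Infinite ((D : Filter ℕ).Product M)] :
    Uncountable ((D : Filter ℕ).Product M) := by
  classical
  by_contra hunc
  rw [not_uncountable_iff] at hunc
  let q : (∀ i, M i) → (D : Filter ℕ).Product M :=
    Quotient.mk ((D : Filter ℕ).productSetoid M)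
  have hq : Function.Surjective q := Quotient.mk_surjective
  obtain ⟨φ, hφ⟩ := exists_surjective_nat ((D : Filter ℕ).Product M)
  choose x hx using fun k => hq (φ k)
  -- Diagonalization: `y` avoids as many listed sequences at `i` as the size of `M i` permits. These
  -- sizes are unbounded along `D`, so each `x k` is eventually avoided.
  have havoid : ∀ i, ∃ y : M i, ∀ k < Nat.card (M i) - 1, x k i ≠ y := by
    intro i
    have := Fintype.ofFinite (M i)
    have hcard : ((Finset.range (Nat.card (M i) - 1)).image fun k => x k i).card
        < (Finset.univ : Finset (M i)).card := by
      refine Finset.card_image_le.trans_lt ?_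
      rw [Finset.card_range, Finset.card_univ, ← Nat.card_eq_fintype_card]
      exact Nat.sub_lt Nat.card_pos one_pos
    obtain ⟨y, -, hy⟩ := Finset.exists_mem_notMem_of_card_lt_card hcard
    exact ⟨y, fun k hk h => hy (Finset.mem_image.2 ⟨k, Finset.mem_range.2 hk, h⟩)⟩
  choose y hy using havoid
  obtain ⟨k, hk⟩ := hφ (q y)
  have hxy : q (x k) = q y := (hx k).trans hk
  have hev : ∀ᶠ i in (D : Filter ℕ), x k i = y i := Quotient.exact hxy
  obtain ⟨i, hi, hlt⟩ := (hev.and (eventually_lt_card_of_infinite D M (k + 1))).exists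
  exact hy i k (by omega) hi

end Ultraproduct

instance finOrderedStructure (m : ℕ) : Language.order.OrderedStructure (Fin m) :=
  ⟨fun _ => Iff.rfl⟩

/-- In a linear order, every set of `m` elements is the carrier of a copy of the `m`-element
linear order. -/
theorem exists_mem_copies_coe_eq {N : Type u₁} [Language.order.Structure N]
    [N ⊨ Language.order.linearOrderTheory] {m : ℕ} (t : Finset N) (ht : t.card = m) :
    ∃ T ∈ copies Language.order (Fin m) N, (T : Set N) = t := by
  classical
  let := Language.order.linearOrderOfModels N
  let T : Language.order.Substructure N := ⟨t, fun f => isEmptyElim f⟩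
  have e : T ≃o Fin m := (t.orderIsoOfFin ht).symm
  exact ⟨T, ⟨Language.StrongHomClass.toEquiv e⟩, rfl⟩

/-- Under the Continuum Hypothesis, `m`-tuples (`m ≥ 2`) have infinite big Ramsey degree in each
linear order of size `ℵ₁`. -/
theorem hasInfiniteBigRamseyDegree_of_mk_eq_aleph_one {N : Type u₁} [Language.order.Structure N]
    [N ⊨ Language.order.linearOrderTheory] (hN : #N = ℵ₁) (hCH : 𝔠 = (ℵ₁ : Cardinal.{u₁}))
    {m : ℕ} (hm : 2 ≤ m) : HasInfiniteBigRamseyDegree Language.order (Fin m) N := by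
  rintro ⟨ℓ, h⟩
  obtain ⟨c, hc⟩ := exists_set_coloring hN hCH
  -- Reducing colors modulo `ℓ + 1` keeps all `ℓ + 1` residues on every copy, one too many.
  obtain ⟨N', ⟨e⟩, hle⟩ := h (ℓ + 1) fun T => Fin.ofNat (ℓ + 1) (c (T.1 : Set N))
  have hN' : ¬ (N' : Set N).Countable := fun hcount => by
    have hlt := lt_aleph_one_iff.2 (le_aleph0_iff_set_countable.2 hcount)
    have heq : #N' = #N := mk_congr e.toEquiv
    exact (heq.trans hN).not_lt hlt
  have huniv : colorsOn Language.order
      (fun T : copies Language.order (Fin m) N => Fin.ofNat (ℓ + 1) (c (T.1 : Set N))) N'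
        = Set.univ := by
    refine eq_univ_of_forall fun j => ?_
    obtain ⟨t, hts, htm, htc⟩ := hc N' hN' m hm j
    obtain ⟨T, hT, hTt⟩ := exists_mem_copies_coe_eq t htm
    refine ⟨⟨T, hT⟩, ?_, ?_⟩
    · intro x hx
      exact hts (hTt ▸ hx)
    · simp only [hTt, htc]
      exact Fin.ofNat_val_eq_self j
  rw [huniv, ncard_univ, Nat.card_fin] at hle
  omega

end BigRamsey

theorem corollary6p2
    (CH : Cardinal.continuum.{0} = Cardinal.aleph.{0} 1)
    (D : Ultrafilter ℕ)
    (M : ℕ → Type*) [∀ i, Finite (M i)] [∀ i, Nonempty (M i)] [∀ i, LinearOrder (M i)]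
    [∀ i, Language.order.Structure (M i)] [∀ i, Language.order.OrderedStructure (M i)]
    (hinf : Infinite ((D : Filter ℕ).Product M))
    (m : ℕ) (hm : 2 ≤ m) :
    BigRamsey.HasInfiniteBigRamseyDegree Language.order (Fin m) ((D : Filter ℕ).Product M) := by
  have hCH : Cardinal.continuum = Cardinal.aleph 1 := by
    simpa using congrArg Cardinal.lift CH
  -- Łoś's theorem transfers the linear order axioms.
  have hmodel : (D : Filter ℕ).Product M ⊨ Language.order.linearOrderTheory :=
    ⟨fun φ hφ => (Language.Ultraproduct.sentence_realize φ).2 (Filter.Eventually.of_forall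
      fun _ => Language.order.linearOrderTheory.realize_sentence_of_mem hφ)⟩
  have := BigRamsey.uncountable_product D M
  refine BigRamsey.hasInfiniteBigRamseyDegree_of_mk_eq_aleph_one (le_antisymm ?_ ?_) hCH hm
  · exact (BigRamsey.mk_product_le_continuum D M).trans_eq hCH
  · exact not_lt.1 fun h => (Cardinal.aleph0_lt_mk_iff.2 this).not_ge
      (Cardinal.lt_aleph_one_iff.1 h)
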